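/- Let $n\in\mathbb N$, $t_0\in\mathbb R$, and consider the system $\dot x=f(t,x)$, $t\ge t_0$, $x\in\mathbb R^n$, where $f$ is piecewise continuous in $t$ and continuously differentiable in $x$ (meaning: $f(t,\cdot)$ is $C^1$ for every $t\ge t_0$, and $f$ and its Jacobian matrix $\partial f/\partial x$ are jointly continuous in $(t,x)$ away from a set of switching times that is finite in every bounded interval, with one-sided limits, locally uniform in $x$, at those times). Assume forward completeness: for every $s\ge t_0$ and $x\in\mathbb R^n$ there is a solution $t\mapsto\xi(t,s,x)$ on $[s,\infty)$ with $\xi(s,s,x)=x$ (understood as a solution of the integral equation). Let $|\cdot|$ be any norm on $\mathbb R^n$ and let $K\subset\mathbb R^n$ be compact with nonempty interior. For $\varepsilon>0$ and $T\ge0$ let $S(f,t_0,\varepsilon,T,K)$ be the smallest cardinality of a set $E\subset K$ such that for every $\bar x\in K$ there is $x\in E$ with $|\xi(t,t_0,\bar x)-\xi(t,t_0,x)|<\varepsilon$ for all $t\in[t_0,t_0+T]$, and let \[ h(f,t_0,K):=\lim_{\varepsilon\searrow0}\limsup_{T\to\infty}\frac1T\log S(f,t_0,\varepsilon,T,K)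 \] be the topological entropy. Write $\xi(t_1,t_0,K)=\{\xi(t_1,t_0,x):x\in K\}$ and let $\mathrm{co}$ denote the convex hull. For $t_1\ge t_0$ and $i,j\in\{1,\dots,n\}$, $i\ne j$, put \[ m_{ii}(t_1):=\sup_{t\ge t_1}\ \max_{v\in\mathrm{co}(\xi(t_1,t_0,K))}\frac{\partial f_i}{\partial x_i}(t,\xi(t,t_1,v)),\qquad m_{ij}(t_1):=\sup_{t\ge t_1}\ \max_{v\in\mathrm{co}(\xi(t_1,t_0,K))}\Bigl|\frac{\partial f_i}{\partial x_j}(t,\xi(t,t_1,v))\Bigr| . \] Let $\bar A^*=[\bar a^*_{ij}]\in\mathbb R^{n\times n}$ be a Metzler matrix (that is, $\bar a^*_{ij}\ge0$ for $i\ne j$) that bounds the infimum of these suprema over $t_1\ge t_0$, the infimum being taken for all entries together: for every $\delta>0$ there is one $t_1\ge t_0$ such that $m_{ij}(t_1)\le\bar a^*_{ij}+\delta$ for all $i,j\in\{1,\dots,n\}$ (including $i=j$). Then \[ h(f,t_0,K)\le n\max\{\alpha(\bar A^*),0\}, \] where $\alpha(\bar A^*)$ is the largest real part of an eigenvalue of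 $\bar A^*$. -/

import Mathlib

open Set Filter Topology MeasureTheory

noncomputable section

namespace TVEntropy

/-- `g(t, x)` is piecewise continuous in `t ≥ t₀`, jointly with `x`: there are only finitely many
switching times in every bounded interval, `g` is continuous on `[t₀, ∞) × X` away from them, and at
each of them `g` has (locally uniform in `x`) one-sided limits. -/
def PiecewiseContinuousInTime {X F : Type*} [TopologicalSpace X] [TopologicalSpace F]
    (g : ℝ → X → F) (t₀ : ℝ) : Prop :=
  ∃ D : Set ℝ,
    (∀ a b : ℝ, (D ∩ Icc a b).Finite) ∧
    (∀ t ∈ Ici t₀ \ D, ∀ x : X,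
      ContinuousWithinAt (fun q : ℝ × X => g q.1 q.2) (Ici t₀ ×ˢ univ) (t, x)) ∧
    (∀ τ ∈ D, t₀ ≤ τ → ∀ x : X,
      ∃ L : F, Tendsto (fun q : ℝ × X => g q.1 q.2) (𝓝[>] τ ×ˢ 𝓝 x) (𝓝 L)) ∧
    (∀ τ ∈ D, t₀ < τ → ∀ x : X,
      ∃ L : F, Tendsto (fun q : ℝ × X => g q.1 q.2) (𝓝[<] τ ×ˢ 𝓝 x) (𝓝 L))

/-- The regularity of the right-hand side of `ẋ = f(t, x)`, `t ≥ t₀`: piecewise continuous in `t`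
and continuously differentiable in `x`. -/
structure IsRegularField {n : ℕ} (f : ℝ → (Fin n → ℝ) → (Fin n → ℝ)) (t₀ : ℝ) : Prop where
  contDiff : ∀ t, t₀ ≤ t → ContDiff ℝ 1 (f t)
  piecewise : PiecewiseContinuousInTime f t₀
  piecewise_jacobian : PiecewiseContinuousInTime (fun t x => fderiv ℝ (f t) x) t₀

/-- `φ` is a solution of `ẋ = f(t, x)` on `[s, ∞)` with `φ s = x`: it is continuous (hence, by the
integral equation, locally absolutely continuous) and satisfies the integrated equation. -/
structure IsSolution {n : ℕ} (f : ℝ → (Fin n → ℝ) → (Fin n → ℝ)) (s : ℝ) (x : Fin n → ℝ)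
    (φ : ℝ → (Fin n → ℝ)) : Prop where
  continuousOn : ContinuousOn φ (Ici s)
  integrable : ∀ t, s ≤ t → IntervalIntegrable (fun r => f r (φ r)) volume s t
  eq : ∀ t, s ≤ t → φ t = x + ∫ r in s..t, f r (φ r)

/-- Forward completeness: from every time `s ≥ t₀` and every state there is a solution on
`[s, ∞)`. -/
def ForwardComplete {n : ℕ} (f : ℝ → (Fin n → ℝ) → (Fin n → ℝ)) (t₀ : ℝ) : Prop :=
  ∀ s, t₀ ≤ s → ∀ x : Fin n → ℝ, ∃ φ : ℝ → (Fin n → ℝ), IsSolution f s x φ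

open Classical in
/-- `flow f t s x = ξ(t, s, x)`, the solution at time `t ≥ s` with state `x` at time `s`. -/
def flow {n : ℕ} (f : ℝ → (Fin n → ℝ) → (Fin n → ℝ)) (t s : ℝ) (x : Fin n → ℝ) : Fin n → ℝ :=
  if h : ∃ φ : ℝ → (Fin n → ℝ), IsSolution f s x φ then h.choose t else x

/-- The ball `B_{f, t₀}(x, ε, T)` for the norm `p`. -/
def ball {n : ℕ} (p : Seminorm ℝ (Fin n → ℝ)) (f : ℝ → (Fin n → ℝ) → (Fin n → ℝ)) (t₀ : ℝ)
    (x : Fin n → ℝ) (ε T : ℝ) : Set (Fin n → ℝ) :=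
  {y | ∀ t ∈ Icc t₀ (t₀ + T), p (flow f t t₀ y - flow f t t₀ x) < ε}

/-- `E ⊆ K` is a `(T, ε)`-spanning set for `K` at initial time `t₀`. -/
def IsSpanning {n : ℕ} (p : Seminorm ℝ (Fin n → ℝ)) (f : ℝ → (Fin n → ℝ) → (Fin n → ℝ)) (t₀ : ℝ)
    (ε T : ℝ) (K E : Set (Fin n → ℝ)) : Prop :=
  E ⊆ K ∧ K ⊆ ⋃ x ∈ E, ball p f t₀ x ε T

/-- `S(f, t₀, ε, T, K)`, the minimal cardinality of a `(T, ε)`-spanning set. -/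
def spanningNumber {n : ℕ} (p : Seminorm ℝ (Fin n → ℝ)) (f : ℝ → (Fin n → ℝ) → (Fin n → ℝ))
    (t₀ ε T : ℝ) (K : Set (Fin n → ℝ)) : ℕ∞ :=
  ⨅ (E : Set (Fin n → ℝ)) (_ : IsSpanning p f t₀ ε T K E), E.encard

/-- `limsup_{T → ∞} (1 / T) log S(f, t₀, ε, T, K)`. -/
def growthRate {n : ℕ} (p : Seminorm ℝ (Fin n → ℝ)) (f : ℝ → (Fin n → ℝ) → (Fin n → ℝ))
    (t₀ : ℝ) (K : Set (Fin n → ℝ)) (ε : ℝ) : EReal :=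
  limsup (fun T : ℝ => ENNReal.log (spanningNumber p f t₀ ε T K : ENNReal) / (T : EReal)) atTop

/-- The topological entropy `h(f, t₀, K)`: the limit of `growthRate` as `ε ↘ 0`, written as a
supremum because the growth rate is nonincreasing in `ε` (see `tendsto_growthRate`). -/
def entropy {n : ℕ} (p : Seminorm ℝ (Fin n → ℝ)) (f : ℝ → (Fin n → ℝ) → (Fin n → ℝ))
    (t₀ : ℝ) (K : Set (Fin n → ℝ)) : EReal :=
  ⨆ (ε : ℝ) (_ : 0 < ε), growthRate p f t₀ K ε

theorem spanningNumber_antitone {n : ℕ} (p : Seminorm ℝ (Fin n → ℝ))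
    (f : ℝ → (Fin n → ℝ) → (Fin n → ℝ)) (t₀ T : ℝ) (K : Set (Fin n → ℝ)) :
    Antitone fun ε => spanningNumber p f t₀ ε T K := by
  intro ε ε' h
  refine le_iInf₂ fun E hE => iInf₂_le E ⟨hE.1, hE.2.trans ?_⟩
  exact iUnion₂_mono fun x _ y hy t ht => (hy t ht).trans_le h

theorem growthRate_antitone {n : ℕ} (p : Seminorm ℝ (Fin n → ℝ))
    (f : ℝ → (Fin n → ℝ) → (Fin n → ℝ)) (t₀ : ℝ) (K : Set (Fin n → ℝ)) :
    Antitone (growthRate p f t₀ K) := by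
  intro ε ε' h
  refine limsup_le_limsup ?_
  filter_upwards [eventually_gt_atTop 0] with T hT
  refine EReal.div_le_div_right_of_nonneg (by exact_mod_cast hT.le) ?_
  refine ENNReal.log_monotone ?_
  exact_mod_cast spanningNumber_antitone p f t₀ T K h

theorem tendsto_growthRate {n : ℕ} (p : Seminorm ℝ (Fin n → ℝ))
    (f : ℝ → (Fin n → ℝ) → (Fin n → ℝ)) (t₀ : ℝ) (K : Set (Fin n → ℝ)) :
    Tendsto (growthRate p f t₀ K) (𝓝[>] 0) (𝓝 (entropy p f t₀ K)) := by
  have h := (growthRate_antitone p f t₀ K).tendsto_nhdsGT 0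
  rwa [sSup_image] at h

/-- The partial derivative `∂f_i / ∂x_j (t, v)`. -/
def partialDeriv {n : ℕ} (f : ℝ → (Fin n → ℝ) → (Fin n → ℝ)) (t : ℝ) (v : Fin n → ℝ)
    (i j : Fin n) : ℝ :=
  fderiv ℝ (f t) v (Pi.single j 1) i

/-- `∂f_i / ∂x_i (t, v)` on the diagonal and `|∂f_i / ∂x_j (t, v)|` off the diagonal. -/
def compEntry {n : ℕ} (f : ℝ → (Fin n → ℝ) → (Fin n → ℝ)) (t : ℝ) (v : Fin n → ℝ)
    (i j : Fin n) : ℝ :=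
  if i = j then partialDeriv f t v i i else |partialDeriv f t v i j|

/-- The supremum over `t ≥ t₁` and `v ∈ co(ξ(t₁, t₀, K))` of `compEntry` at `(t, ξ(t, t₁, v))`. -/
def supEntry {n : ℕ} (f : ℝ → (Fin n → ℝ) → (Fin n → ℝ)) (t₀ : ℝ) (K : Set (Fin n → ℝ))
    (t₁ : ℝ) (i j : Fin n) : EReal :=
  ⨆ t ∈ Ici t₁, ⨆ v ∈ convexHull ℝ (flow f t₁ t₀ '' K),
    (compEntry f t (flow f t t₁ v) i j : EReal)

/-- A real matrix is Metzler if its off-diagonal entries are nonnegative. -/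
def IsMetzler {n : ℕ} (A : Matrix (Fin n) (Fin n) ℝ) : Prop :=
  ∀ i j : Fin n, i ≠ j → 0 ≤ A i j

/-- The largest real part of a (complex) eigenvalue of `A`. -/
def spectralAbscissa {n : ℕ} (A : Matrix (Fin n) (Fin n) ℝ) : ℝ :=
  sSup (Complex.re '' spectrum ℂ (A.map (fun a : ℝ => (a : ℂ))))

end TVEntropy

end

namespace TVEntropy

/-! Fix `μ > max (α(A)) 0` and `c` strictly between `α(A)` and `μ`. Perron–Frobenius theory for the
Metzler matrix `A` supplies a positive vector `u` with `A u < c u` componentwise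
(`IsMetzler.exists_pos_mulVec_lt`), and the strict inequality survives adding a small `δ` to every
entry. In the weighted norm `max |z i| / u i`, the logarithmic norm of a Jacobian is bounded by the
weighted row sums of its comparison matrix (`norm_add_smul_fderiv_le`), hence by `c` along every
trajectory issued at `t₁` from the convex hull of `ξ(t₁, t₀, K)`.

The difference of two neighbouring solutions obeys the linearised equation up to a small relative
error, which the gap `μ - c` absorbs, so it grows at most like `exp (μ (t - t₁))`
(`norm_le_mul_exp_of_logNorm_le`). This needs no derivative of the flow in the initial state. The
estimate is local around each trajectory; chaining it along the segment joining two points makes it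
global, which is why the hull of the image appears (`ForwardComplete.norm_flow_sub_flow_le`).

To keep trajectories `ε`-close up to time `t₀ + T` it then suffices to cut the image at time `t₁`
into boxes of side proportional to `exp (-μ T)`. There are at most a constant times `exp (n μ T)` of
them, and the initial interval `[t₀, t₁]` costs only a fixed factor
(`ForwardComplete.exists_spanningNumber_le`). Hence the growth rate is at most `n μ`, and `μ`
decreases to `max (α(A)) 0`. -/

/-! ### Metzler matrices and positive weights. -/

/-- A vanishing determinant makes `c` an eigenvalue; finiteness of the spectrum bounds the set under
the supremum, so `c` could not exceed it. -/
theorem det_scalar_sub_ne_zero_of_spectralAbscissa_lt {n : ℕ} (A : Matrix (Fin n) (Fin n) ℝ) {c : ℝ}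
    (hc : spectralAbscissa A < c) : (Matrix.scalar (Fin n) c - A).det ≠ 0 := by
  intro h0
  have hmem : (c : ℂ) ∈ spectrum ℂ (A.map (fun a : ℝ => (a : ℂ))) := by
    rw [spectrum.mem_iff, Matrix.isUnit_iff_isUnit_det]
    have : algebraMap ℂ (Matrix (Fin n) (Fin n) ℂ) (c : ℂ) - A.map (fun a : ℝ => (a : ℂ))
        = (Complex.ofRealHom).mapMatrix (Matrix.scalar (Fin n) c - A) := by
      ext i j
      by_cases hij : i = j
      · subst hij; simp [Matrix.algebraMap_matrix_apply]
      · simp [Matrix.algebraMap_matrix_apply, hij]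
    rw [this, ← RingHom.map_det, h0]
    simp
  have hfin : (spectrum ℂ (A.map (fun a : ℝ => (a : ℂ)))).Finite := Matrix.finite_spectrum _
  have := le_csSup (hfin.image Complex.re).bddAbove ⟨_, hmem, rfl⟩
  simp only [Complex.ofReal_re] at this
  exact absurd hc (not_lt.2 this)

/-- A Metzler matrix has a positive strict subsolution at every level above its spectral
abscissa. -/
theorem IsMetzler.exists_pos_mulVec_lt {n : ℕ} {A : Matrix (Fin n) (Fin n) ℝ} (hA : IsMetzler A)
    {c : ℝ} (hc : spectralAbscissa A < c) :
    ∃ u : Fin n → ℝ, (∀ i, 0 < u i) ∧ ∀ i, ∑ j, A i j * u j < c * u i := by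
  set R : ℝ → Matrix (Fin n) (Fin n) ℝ := fun r => Matrix.scalar (Fin n) r - A with hR
  set w : ℝ → Fin n → ℝ := fun r => (R r)⁻¹.mulVec 1 with hw
  have hRcont : Continuous R := by
    have : Continuous fun r : ℝ => Matrix.scalar (Fin n) r := by
      simp only [Matrix.scalar_apply]
      exact Continuous.matrix_diagonal (by fun_prop)
    exact this.sub continuous_const
  have hsol : ∀ r, spectralAbscissa A < r → ∀ i, ∑ j, A i j * w r j + 1 = r * w r i := by
    intro r hr i
    have hdet := det_scalar_sub_ne_zero_of_spectralAbscissa_lt A hr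
    have h1 : (R r).mulVec (w r) = 1 := by
      rw [hw, Matrix.mulVec_mulVec, Matrix.mul_nonsing_inv _ (Ne.isUnit hdet), Matrix.one_mulVec]
    have h2 := congrFun h1 i
    simp only [hR, Matrix.sub_mulVec, Pi.sub_apply, Matrix.scalar_apply, Matrix.mulVec_diagonal,
      Pi.one_apply] at h2
    simp only [Matrix.mulVec, dotProduct] at h2
    linarith
  -- At a zero coordinate the equation of `hsol` would equate `0` with a nonnegative sum plus `1`.
  have hpos : ∀ r, spectralAbscissa A < r → (∀ i, 0 ≤ w r i) → ∀ i, 0 < w r i := by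
    intro r hr h0 i
    refine lt_of_le_of_ne (h0 i) fun h => ?_
    have := hsol r hr i
    rw [← h, mul_zero] at this
    have h3 : 0 ≤ ∑ j, A i j * w r j := by
      refine Finset.sum_nonneg fun j _ => ?_
      by_cases hij : i = j
      · rw [← hij, ← h, mul_zero]
      · exact mul_nonneg (hA i j hij) (h0 j)
    linarith
  have hwcont : ContinuousOn w (Ioi (spectralAbscissa A)) := by
    have : ∀ r, w r = (R r).det⁻¹ • (R r).adjugate.mulVec 1 := by
      intro r
      simp only [hw, Matrix.inv_def, Matrix.smul_mulVec, Ring.inverse_eq_inv']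
    simp only [funext this]
    refine ContinuousOn.smul (ContinuousOn.inv₀ (hRcont.matrix_det).continuousOn
      fun r hr => det_scalar_sub_ne_zero_of_spectralAbscissa_lt A hr) ?_
    exact (hRcont.matrix_adjugate.matrix_mulVec continuous_const).continuousOn
  -- Beyond all absolute row sums `b - A` is strictly diagonally dominant, so positivity can be
  -- checked directly there.
  obtain ⟨b, hb⟩ : ∃ b, spectralAbscissa A < b ∧ ∀ i, ∑ j, |A i j| < b := by
    refine ⟨|spectralAbscissa A| + ∑ i, ∑ j, |A i j| + 1, ?_, fun i => ?_⟩
    · have := le_abs_self (spectralAbscissa A)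
      have : 0 ≤ ∑ i, ∑ j, |A i j| := by positivity
      linarith
    · have h1 : ∑ j, |A i j| ≤ ∑ i, ∑ j, |A i j| :=
        Finset.single_le_sum (f := fun i => ∑ j, |A i j|) (fun i _ => by positivity)
          (Finset.mem_univ i)
      have := abs_nonneg (spectralAbscissa A)
      linarith
  have hwb : ∀ i, 0 ≤ w b i := by
    rcases isEmpty_or_nonempty (Fin n) with h | h
    · exact fun i => (h.false i).elim
    -- Minimum principle: at a negative minimal coordinate, row `k` would give `(b - ∑ j, |A k j|) *
    -- w b k ≥ 1`, although the left side is negative.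
    obtain ⟨k, hk⟩ := Finite.exists_min (w b)
    by_contra! hneg
    obtain ⟨i, hi⟩ := hneg
    have hk0 : w b k < 0 := (hk i).trans_lt hi
    have h1 := hsol b hb.1 k
    have h2 : (∑ j, |A k j|) * w b k ≤ ∑ j, A k j * w b j := by
      rw [Finset.sum_mul]
      refine Finset.sum_le_sum fun j _ => ?_
      by_cases hkj : k = j
      · subst hkj
        exact mul_le_mul_of_nonpos_right (le_abs_self _) hk0.le
      · rw [abs_of_nonneg (hA k j hkj)]
        exact mul_le_mul_of_nonneg_left (hk j) (hA k j hkj)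
    nlinarith [hb.2 k]
  -- Positivity of `w r` is open in `r` by continuity and closed because limits are nonnegative and
  -- `hpos` upgrades them; connectedness carries it from `b` to the whole half-line.
  have key : Ioi (spectralAbscissa A) ⊆ {r | ∀ i, 0 < w r i} := by
    refine IsPreconnected.subset_of_closure_inter_subset isPreconnected_Ioi
      (u := Ioi (spectralAbscissa A) ∩ {r | ∀ i, 0 < w r i}) ?_ ⟨b, hb.1, hb.1, hpos b hb.1 hwb⟩ ?_
      |>.trans inter_subset_right
    · have : IsOpen {v : Fin n → ℝ | ∀ i, 0 < v i} := by
        simp only [Set.ofPred_forall]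
        exact isOpen_iInter_of_finite fun i => isOpen_lt continuous_const (continuous_apply i)
      exact hwcont.isOpen_inter_preimage isOpen_Ioi this
    · rintro r ⟨hr, hr'⟩
      refine ⟨hr', hpos r hr' fun i => ?_⟩
      have hci : ContinuousAt (fun r => w r i) r :=
        (continuous_apply i).continuousAt.comp (hwcont.continuousAt (isOpen_Ioi.mem_nhds hr'))
      by_contra! hlt
      obtain ⟨x, hx1, hx2⟩ := mem_closure_iff_nhds.1 hr _ (hci.eventually_lt_const hlt)
      exact absurd (hx2.2 i) (not_lt.2 hx1.le)
  exact ⟨w c, key hc, fun i => by linarith [hsol c hc i]⟩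

/-! ### Growth of nearly linear curves. -/

/-- Growth estimate for a curve whose velocity is nearly linear in the curve, in terms of a bound on
the logarithmic norm of the linear part. -/
theorem norm_le_mul_exp_of_logNorm_le {E : Type*} [NormedAddCommGroup E] [NormedSpace ℝ E]
    [CompleteSpace E] {d g : ℝ → E} {J : ℝ → E →L[ℝ] E} {s T M ρ η h₀ μ' μ β : ℝ}
    (hd : ContinuousOn d (Icc s T)) (hg : ∀ t ∈ Icc s T, IntervalIntegrable g volume s t)
    (hdg : ∀ t ∈ Icc s T, d t = d s + ∫ r in s..t, g r)
    (hM : ∀ r ∈ Icc s T, ‖J r‖ ≤ M)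
    (hη : 0 ≤ η) (hrem : ∀ r ∈ Icc s T, ‖d r‖ < ρ → ‖g r - J r (d r)‖ ≤ η * ‖d r‖)
    (hh₀ : 0 < h₀)
    (hlog : ∀ h, 0 < h → h < h₀ → ∀ r ∈ Icc s T, ∀ z, ‖z + h • J r z‖ ≤ (1 + h * μ') * ‖z‖)
    (hμ : μ' + η < μ) (hβ : 0 < β) (hβρ : β * Real.exp (|μ| * (T - s)) < ρ) (hds : ‖d s‖ ≤ β) :
    ∀ t ∈ Icc s T, ‖d t‖ ≤ β * Real.exp (μ * (t - s)) := by
  set B : ℝ → ℝ := fun t => β * Real.exp (μ * (t - s)) with hB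
  have hBcont : Continuous B := by fun_prop
  rcases lt_or_ge T s with hTs | hTs
  · intro t ht; exact absurd (ht.1.trans ht.2) (not_le.2 hTs)
  have hM0 : 0 ≤ M := (norm_nonneg _).trans (hM s ⟨le_rfl, hTs⟩)
  suffices Icc s T ⊆ {t | ‖d t‖ ≤ B t} from this
  refine IsClosed.Icc_subset_of_forall_exists_gt ?_ (by simpa [hB] using hds) ?_
  · have := isClosed_Icc.isClosed_le (hd.norm) (hBcont.continuousOn (s := Icc s T))
    convert this using 1
    ext t; simp [and_comm]
  · rintro x ⟨hxB, hx⟩ y hxy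
    have hBx : 0 < B x := by positivity
    have hBρ : B x < ρ := by
      refine lt_of_le_of_lt ?_ hβρ
      refine mul_le_mul_of_nonneg_left (Real.exp_le_exp.2 ?_) hβ.le
      have h1 : 0 ≤ x - s := sub_nonneg.2 hx.1
      calc μ * (x - s) ≤ |μ| * (x - s) := mul_le_mul_of_nonneg_right (le_abs_self _) h1
        _ ≤ |μ| * (T - s) := mul_le_mul_of_nonneg_left (by linarith [hx.2]) (abs_nonneg _)
    -- The slack between the rates `μ' + η` and `μ` at height `B x`; it absorbs the variation of `d`
    -- over one step and is positive even if `d x = 0`.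
    set κ : ℝ := (μ - μ' - η) * B x with hκ
    have hκ0 : 0 < κ := mul_pos (by linarith) hBx
    have hdx : ContinuousWithinAt d (Icc s T) x := hd x ⟨hx.1, hx.2.le⟩
    have hmem : Icc s T ∈ 𝓝[≥] x := Icc_mem_nhdsGE_of_mem hx
    have hdx' : ContinuousWithinAt d (Ici x) x := hdx.mono_of_mem_nhdsWithin hmem
    have hev : ∀ᶠ r in 𝓝[≥] x, r ∈ Icc s T ∧ ‖d r‖ < ρ ∧
        M * ‖d r - d x‖ + η * ‖d r‖ < η * ‖d x‖ + κ := by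
      have h1 : Tendsto (fun r => ‖d r‖) (𝓝[≥] x) (𝓝 ‖d x‖) := hdx'.norm
      have h2 : Tendsto (fun r => M * ‖d r - d x‖ + η * ‖d r‖) (𝓝[≥] x)
          (𝓝 (M * ‖d x - d x‖ + η * ‖d x‖)) :=
        ((hdx'.sub continuousWithinAt_const).norm.const_mul M).add (h1.const_mul η)
      refine (eventually_mem_set.2 hmem).and ((h1.eventually_lt_const ?_).and
        (h2.eventually_lt_const ?_))
      · exact lt_of_le_of_lt hxB hBρ
      · simpa using hκ0
    obtain ⟨c, hc, hcsub⟩ := (mem_nhdsGE_iff_exists_Ico_subset).1 hev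
    have hc : x < c := hc
    have hxy : x < y := hxy
    -- For `h < h₁` the factor `1 + h * μ' + h * η` stays nonnegative even for negative `μ'`, so `‖d
    -- x‖` may be replaced by `B x`.
    obtain ⟨h₁, hh₁, hh₁lt⟩ : ∃ h₁ > 0, ∀ h, h < h₁ → |h * μ'| < 1 ∨ h ≤ 0 := by
      refine ⟨1 / (|μ'| + 1), by positivity, fun h hh => ?_⟩
      rcases le_or_gt h 0 with h0 | h0
      · exact Or.inr h0
      · left
        rw [abs_mul, abs_of_pos h0]
        rw [lt_div_iff₀ (by positivity)] at hh
        nlinarith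
    obtain ⟨h, hh0, hhlt⟩ := exists_between
      (show 0 < min (min (c - x) (y - x)) (min h₀ h₁) by
        simp only [lt_min_iff]; exact ⟨⟨by linarith, by linarith⟩, hh₀, hh₁⟩)
    simp only [lt_min_iff] at hhlt
    obtain ⟨⟨hhc, hhy⟩, hhh₀, hhh₁⟩ := hhlt
    have hsub : ∀ r ∈ Icc x (x + h), r ∈ Icc s T ∧ ‖d r‖ < ρ ∧
        M * ‖d r - d x‖ + η * ‖d r‖ < η * ‖d x‖ + κ :=
      fun r hr => hcsub ⟨hr.1, by linarith [hr.2]⟩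
    have hxh : x + h ∈ Icc s T := (hsub (x + h) ⟨by linarith, le_rfl⟩).1
    have hx' : x ∈ Icc s T := ⟨hx.1, hx.2.le⟩
    have hgi : IntervalIntegrable g volume x (x + h) := (hg x hx').symm.trans (hg _ hxh)
    have hdiff : d (x + h) = d x + ∫ r in x..(x + h), g r := by
      rw [hdg _ hxh, hdg x hx', add_assoc, intervalIntegral.integral_add_adjacent_intervals
        (hg x hx') hgi]
    -- Writing `d (x + h)` as an average over the step lets the logarithmic norm bound act on the
    -- integrand at fixed `h`; no differentiability of `d` is required.
    have hrep : h • d (x + h) = ∫ r in x..(x + h), (d x + h • g r) := by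
      rw [intervalIntegral.integral_add intervalIntegrable_const
        (show IntervalIntegrable (fun r => h • g r) volume x (x + h) from hgi.smul h),
        intervalIntegral.integral_const, intervalIntegral.integral_smul, hdiff, smul_add]
      simp
    have hbound : ∀ r ∈ uIoc x (x + h),
        ‖d x + h • g r‖ ≤ (1 + h * μ') * ‖d x‖ + h * (η * ‖d x‖ + κ) := by
      intro r hr
      rw [uIoc_of_le (by linarith)] at hr
      obtain ⟨hrI, hrρ, hrκ⟩ := hsub r ⟨hr.1.le, hr.2⟩
      have e : d x + h • g r = (d x + h • J r (d x)) + h • (J r (d r - d x))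
          + h • (g r - J r (d r)) := by
        rw [map_sub]; module
      rw [e]
      refine (norm_add₃_le).trans ?_
      rw [norm_smul, norm_smul, Real.norm_of_nonneg hh0.le]
      have h1 := hlog h hh0 hhh₀ r hrI (d x)
      have h2 : ‖J r (d r - d x)‖ ≤ M * ‖d r - d x‖ :=
        (J r).le_of_opNorm_le (hM r hrI) _
      have h3 := hrem r hrI hrρ
      nlinarith
    have hfin := intervalIntegral.norm_integral_le_of_norm_le_const hbound
    rw [← hrep, norm_smul, Real.norm_of_nonneg hh0.le, add_sub_cancel_left, abs_of_pos hh0,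
      mul_comm] at hfin
    have hfin' := le_of_mul_le_mul_right hfin hh0
    refine ⟨x + h, ?_, by linarith, by linarith⟩
    refine hfin'.trans ?_
    have hxB : ‖d x‖ ≤ B x := hxB
    have hμh : 0 ≤ 1 + h * μ' + h * η := by
      rcases hh₁lt h hhh₁ with h' | h'
      · have := (abs_lt.1 h').1
        nlinarith [mul_nonneg hh0.le hη]
      · linarith
    have hBh : B (x + h) = B x * Real.exp (μ * h) := by
      simp only [hB]; rw [mul_assoc, ← Real.exp_add]; congr 2; ring
    calc (1 + h * μ') * ‖d x‖ + h * (η * ‖d x‖ + κ)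
        = (1 + h * μ' + h * η) * ‖d x‖ + h * κ := by ring
      _ ≤ (1 + h * μ' + h * η) * B x + h * κ := by
          gcongr
      _ = B x * (μ * h + 1) := by rw [hκ]; ring
      _ ≤ B (x + h) := by
          rw [hBh]
          exact mul_le_mul_of_nonneg_left (Real.add_one_le_exp _) hBx.le

/-! ### Uniformity of piecewise continuous maps along curves. -/

/-- Near `(τ, x)` a piecewise continuous map is uniformly close to a bounded function of time
alone. -/
theorem PiecewiseContinuousInTime.exists_tendsto_dist {X F : Type*} [TopologicalSpace X]
    [PseudoMetricSpace F] {g : ℝ → X → F} {t₀ : ℝ} (hg : PiecewiseContinuousInTime g t₀) {τ : ℝ}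
    (hτ : t₀ ≤ τ) (hc : Continuous (g τ)) (x : X) :
    ∃ (L : ℝ → F) (B : ℝ), (∀ t, dist (L t) (g τ x) ≤ B) ∧
      Tendsto (fun q : ℝ × X => dist (g q.1 q.2) (L q.1)) (𝓝[Ici t₀] τ ×ˢ 𝓝 x) (𝓝 0) := by
  obtain ⟨D, -, hcont, hright, hleft⟩ := hg
  by_cases hD : τ ∈ D
  · obtain ⟨R, hR⟩ := hright τ hD hτ x
    obtain ⟨L, hL⟩ : ∃ L : F,
        Tendsto (fun q : ℝ × X => g q.1 q.2) (𝓝[Ico t₀ τ] τ ×ˢ 𝓝 x) (𝓝 L) := by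
      rcases hτ.eq_or_lt with h | h
      -- At `τ = t₀` there are no times to the left, so any value serves.
      · exact ⟨g τ x, by simp [h]⟩
      · obtain ⟨L, hL⟩ := hleft τ hD h x
        exact ⟨L, hL.mono_left (prod_mono_left _ (nhdsWithin_mono _ fun t ht => ht.2))⟩
    have hmid : Tendsto (fun q : ℝ × X => g q.1 q.2) (pure τ ×ˢ 𝓝 x) (𝓝 (g τ x)) := by
      rw [pure_prod, tendsto_map'_iff]
      exact hc.tendsto x
    have hsplit : 𝓝[Ici t₀] τ = 𝓝[Ico t₀ τ] τ ⊔ pure τ ⊔ 𝓝[>] τ := by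
      rw [← nhdsWithin_singleton, ← nhdsWithin_union, ← nhdsWithin_union]
      congr 1
      ext t
      simp only [mem_Ici, mem_union, mem_Ico, mem_singleton_iff, mem_Ioi]
      grind
    refine ⟨fun t => if t < τ then L else if t = τ then g τ x else R,
      dist L (g τ x) + dist R (g τ x), fun t => ?_, ?_⟩
    · have h1 : 0 ≤ dist L (g τ x) := dist_nonneg
      have h2 : 0 ≤ dist R (g τ x) := dist_nonneg
      dsimp only
      split_ifs
      · linarith
      · rw [dist_self]; linarith
      · linarith
    · rw [hsplit, sup_prod, sup_prod, tendsto_sup, tendsto_sup]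
      refine ⟨⟨?_, ?_⟩, ?_⟩
      · refine (tendsto_iff_dist_tendsto_zero.1 hL).congr' ?_
        have : ∀ᶠ t in 𝓝[Ico t₀ τ] τ, t ∈ Ico t₀ τ := self_mem_nhdsWithin
        filter_upwards [this.prod_inl (𝓝 x)] with q hq
        rw [if_pos hq.2]
      · refine (tendsto_iff_dist_tendsto_zero.1 hmid).congr' ?_
        have : ∀ᶠ t in pure τ, t = τ := eventually_pure.2 rfl
        filter_upwards [this.prod_inl (𝓝 x)] with q hq
        rw [if_neg (by simp [hq]), if_pos hq]
      · refine (tendsto_iff_dist_tendsto_zero.1 hR).congr' ?_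
        have : ∀ᶠ t in 𝓝[>] τ, t ∈ Ioi τ := self_mem_nhdsWithin
        filter_upwards [this.prod_inl (𝓝 x)] with q hq
        have hq : τ < q.1 := hq
        rw [if_neg (by simp [hq.le]), if_neg hq.ne']
  · refine ⟨fun _ => g τ x, 0, by simp, ?_⟩
    have h := hcont τ ⟨hτ, hD⟩ x
    rw [ContinuousWithinAt, nhdsWithin_prod_eq, nhdsWithin_univ] at h
    exact tendsto_iff_dist_tendsto_zero.1 h

/-- Along a continuous curve over a compact time interval, a piecewise continuous map has a uniform
modulus of continuity in space. -/
theorem PiecewiseContinuousInTime.exists_forall_dist_le {X F : Type*} [PseudoMetricSpace X]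
    [PseudoMetricSpace F] {g : ℝ → X → F} {t₀ : ℝ} (hg : PiecewiseContinuousInTime g t₀)
    (hc : ∀ t, t₀ ≤ t → Continuous (g t)) {φ : ℝ → X} {s T : ℝ} (hs : t₀ ≤ s)
    (hφ : ContinuousOn φ (Icc s T)) {η : ℝ} (hη : 0 < η) :
    ∃ ρ > 0, ∀ t ∈ Icc s T, ∀ z, dist z (φ t) < ρ → dist (g t z) (g t (φ t)) ≤ η := by
  -- Compactness induction runs over arbitrary sets of times, so membership in the interval moves
  -- into the predicate.
  suffices H : ∃ ρ > 0, ∀ t ∈ Icc s T, t ∈ Icc s T → ∀ z, dist z (φ t) < ρ →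
      dist (g t z) (g t (φ t)) ≤ η by
    obtain ⟨ρ, h1, h2⟩ := H
    exact ⟨ρ, h1, fun t ht => h2 t ht ht⟩
  refine isCompact_Icc.induction_on (s := Icc s T)
    (p := fun S => ∃ ρ > 0, ∀ t ∈ S, t ∈ Icc s T → ∀ z, dist z (φ t) < ρ →
      dist (g t z) (g t (φ t)) ≤ η) ⟨1, one_pos, by simp⟩ ?_ ?_ ?_
  · rintro S S' hS ⟨ρ, h1, h2⟩
    exact ⟨ρ, h1, fun t ht => h2 t (hS ht)⟩
  · rintro S S' ⟨ρ, h1, h2⟩ ⟨ρ', h1', h2'⟩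
    refine ⟨min ρ ρ', lt_min h1 h1', ?_⟩
    rintro t (ht | ht) htI z hz
    · exact h2 t ht htI z (hz.trans_le (min_le_left _ _))
    · exact h2' t ht htI z (hz.trans_le (min_le_right _ _))
  · intro τ hτ
    obtain ⟨L, -, -, hL⟩ := hg.exists_tendsto_dist (hs.trans hτ.1) (hc τ (hs.trans hτ.1)) (φ τ)
    have hev := hL.eventually_lt_const (half_pos hη)
    obtain ⟨U, hU, V, hV, hUV⟩ := eventually_prod_iff.1 hev
    obtain ⟨ρ, hρ, hρV⟩ := Metric.eventually_nhds_iff.1 hV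
    have h1 : ∀ᶠ t in 𝓝[Icc s T] τ, U t :=
      hU.filter_mono (nhdsWithin_mono _ fun t ht => hs.trans ht.1)
    have h2 : ∀ᶠ t in 𝓝[Icc s T] τ, dist (φ t) (φ τ) < ρ / 2 :=
      (hφ τ hτ).eventually (Metric.ball_mem_nhds _ (half_pos hρ))
    refine ⟨_, h1.and h2, ρ / 2, half_pos hρ, ?_⟩
    rintro t ⟨htU, htφ⟩ - z hz
    have hz' : dist z (φ τ) < ρ := by
      have := dist_triangle z (φ t) (φ τ); linarith
    have a := hUV htU (hρV hz')
    have b := hUV htU (hρV (show dist (φ t) (φ τ) < ρ by linarith))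
    have := dist_triangle_right (g t z) (g t (φ t)) (L t)
    dsimp only at a b
    linarith

/-- A piecewise continuous map is bounded along a continuous curve over a compact time interval. -/
theorem PiecewiseContinuousInTime.exists_forall_norm_le {X F : Type*} [PseudoMetricSpace X]
    [SeminormedAddCommGroup F] {g : ℝ → X → F} {t₀ : ℝ} (hg : PiecewiseContinuousInTime g t₀)
    (hc : ∀ t, t₀ ≤ t → Continuous (g t)) {φ : ℝ → X} {s T : ℝ} (hs : t₀ ≤ s)
    (hφ : ContinuousOn φ (Icc s T)) :
    ∃ M, 0 ≤ M ∧ ∀ t ∈ Icc s T, ‖g t (φ t)‖ ≤ M := by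
  suffices H : ∃ M, 0 ≤ M ∧ ∀ t ∈ Icc s T, t ∈ Icc s T → ‖g t (φ t)‖ ≤ M by
    obtain ⟨M, h1, h2⟩ := H
    exact ⟨M, h1, fun t ht => h2 t ht ht⟩
  refine isCompact_Icc.induction_on (s := Icc s T)
    (p := fun S => ∃ M, 0 ≤ M ∧ ∀ t ∈ S, t ∈ Icc s T → ‖g t (φ t)‖ ≤ M)
    ⟨0, le_rfl, by simp⟩ ?_ ?_ ?_
  · rintro S S' hS ⟨M, h1, h2⟩
    exact ⟨M, h1, fun t ht => h2 t (hS ht)⟩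
  · rintro S S' ⟨M, h1, h2⟩ ⟨M', h1', h2'⟩
    refine ⟨max M M', le_max_of_le_left h1, ?_⟩
    rintro t (ht | ht) htI
    · exact (h2 t ht htI).trans (le_max_left _ _)
    · exact (h2' t ht htI).trans (le_max_right _ _)
  · intro τ hτ
    obtain ⟨L, B, hB, hL⟩ :=
      hg.exists_tendsto_dist (hs.trans hτ.1) (hc τ (hs.trans hτ.1)) (φ τ)
    obtain ⟨U, hU, V, hV, hUV⟩ := eventually_prod_iff.1 (hL.eventually_lt_const one_pos)
    have h1 : ∀ᶠ t in 𝓝[Icc s T] τ, U t :=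
      hU.filter_mono (nhdsWithin_mono _ fun t ht => hs.trans ht.1)
    have h2 : ∀ᶠ t in 𝓝[Icc s T] τ, V (φ t) := (hφ τ hτ).eventually hV
    refine ⟨_, h1.and h2, |1 + B + ‖g τ (φ τ)‖|, abs_nonneg _, ?_⟩
    rintro t ⟨htU, htV⟩ -
    have a := hUV htU htV
    dsimp only at a
    have b := hB t
    have c : ‖g t (φ t)‖ ≤ dist (g t (φ t)) (g τ (φ τ)) + ‖g τ (φ τ)‖ := by
      rw [dist_eq_norm]; simpa using norm_add_le (g t (φ t) - g τ (φ τ)) (g τ (φ τ))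
    have := dist_triangle (g t (φ t)) (L t) (g τ (φ τ))
    exact le_trans (by linarith) (le_abs_self _)

/-! ### Weighted sup norms and the Jacobian. -/

/-- Coordinatewise multiplication by `c`, as a continuous linear map. -/
def diagScale {n : ℕ} (c : Fin n → ℝ) : (Fin n → ℝ) →L[ℝ] (Fin n → ℝ) :=
  ContinuousLinearMap.pi fun i => c i • ContinuousLinearMap.proj i

@[simp]
theorem diagScale_apply {n : ℕ} (c z : Fin n → ℝ) (i : Fin n) : diagScale c z i = c i * z i := by
  simp [diagScale]

theorem diagScale_diagScale_inv {n : ℕ} {u : Fin n → ℝ} (hu : ∀ i, 0 < u i) (z : Fin n → ℝ) :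
    diagScale u (diagScale u⁻¹ z) = z := by
  ext i
  simp [(hu i).ne']

theorem diagScale_inv_diagScale {n : ℕ} {u : Fin n → ℝ} (hu : ∀ i, 0 < u i) (z : Fin n → ℝ) :
    diagScale u⁻¹ (diagScale u z) = z := by
  ext i
  simp [(hu i).ne']

theorem fderiv_apply_eq_sum_partialDeriv {n : ℕ} (f : ℝ → (Fin n → ℝ) → (Fin n → ℝ)) (t : ℝ)
    (v z : Fin n → ℝ) (i : Fin n) :
    fderiv ℝ (f t) v z i = ∑ j, partialDeriv f t v i j * z j := by
  have hz : z = ∑ j, z j • Pi.single (M := fun _ => ℝ) j (1 : ℝ) := by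
    simp [← Pi.single_smul, Finset.univ_sum_single]
  conv_lhs => rw [hz, map_sum, Finset.sum_apply]
  refine Finset.sum_congr rfl fun j _ => ?_
  rw [map_smul, Pi.smul_apply, smul_eq_mul, mul_comm, partialDeriv]

/-- A weighted row-sum bound on the comparison matrix bounds the logarithmic norm of the Jacobian,
for the weighted sup norm. -/
theorem norm_add_smul_fderiv_le {n : ℕ} {f : ℝ → (Fin n → ℝ) → (Fin n → ℝ)} {t : ℝ}
    {v u : Fin n → ℝ} (hu : ∀ i, 0 < u i) {M c h : ℝ} (hM : ‖fderiv ℝ (f t) v‖ ≤ M)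
    (hc : ∀ i, ∑ j, compEntry f t v i j * u j ≤ c * u i) (hh : 0 < h) (hhM : h * M ≤ 1)
    (z : Fin n → ℝ) :
    ‖diagScale u⁻¹ z + h • diagScale u⁻¹ (fderiv ℝ (f t) v z)‖ ≤
      (1 + h * c) * ‖diagScale u⁻¹ z‖ := by
  rcases isEmpty_or_nonempty (Fin n) with hn | hn
  · have h0 : diagScale u⁻¹ z = 0 := Subsingleton.elim _ _
    have h1 : diagScale u⁻¹ (fderiv ℝ (f t) v z) = 0 := Subsingleton.elim _ _
    rw [h0, h1]; simp
  rw [pi_norm_le_iff_of_nonempty]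
  intro i
  set N := ‖diagScale u⁻¹ z‖ with hN
  have hN0 : 0 ≤ N := norm_nonneg _
  have hz : ∀ j, |z j| ≤ u j * N := by
    intro j
    have := norm_le_pi_norm (diagScale u⁻¹ z) j
    rw [diagScale_apply, Pi.inv_apply, Real.norm_eq_abs, abs_mul, abs_inv, abs_of_pos (hu j),
      inv_mul_le_iff₀ (hu j)] at this
    exact this
  -- This sign lets the diagonal entry enter without absolute value; it is why small `h` is
  -- required.
  have hdiag : 0 ≤ 1 + h * partialDeriv f t v i i := by
    have h1 : |partialDeriv f t v i i| ≤ M := by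
      rw [← Real.norm_eq_abs]
      refine (norm_le_pi_norm (fderiv ℝ (f t) v (Pi.single i 1)) i).trans ?_
      refine ((fderiv ℝ (f t) v).le_opNorm _).trans ?_
      simpa [Pi.norm_single] using hM
    have h2 := (abs_le.1 h1).1
    nlinarith
  have hsum : |z i + h * ∑ j, partialDeriv f t v i j * z j| ≤
      (u i + h * ∑ j, compEntry f t v i j * u j) * N := by
    rw [← Finset.add_sum_erase _ _ (Finset.mem_univ i),
      ← Finset.add_sum_erase _ (fun j => compEntry f t v i j * u j) (Finset.mem_univ i)]
    have e1 : |∑ j ∈ Finset.univ.erase i, partialDeriv f t v i j * z j| ≤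
        (∑ j ∈ Finset.univ.erase i, compEntry f t v i j * u j) * N := by
      refine (Finset.abs_sum_le_sum_abs _ _).trans ?_
      rw [Finset.sum_mul]
      refine Finset.sum_le_sum fun j hj => ?_
      rw [compEntry, if_neg (Finset.ne_of_mem_erase hj).symm, abs_mul, mul_assoc]
      exact mul_le_mul_of_nonneg_left (hz j) (abs_nonneg _)
    have e2 : |(1 + h * partialDeriv f t v i i) * z i| ≤
        (1 + h * partialDeriv f t v i i) * (u i * N) := by
      rw [abs_mul, abs_of_nonneg hdiag]
      exact mul_le_mul_of_nonneg_left (hz i) hdiag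
    have e3 : compEntry f t v i i = partialDeriv f t v i i := if_pos rfl
    rw [e3]
    set S := ∑ j ∈ Finset.univ.erase i, partialDeriv f t v i j * z j
    calc |z i + h * (partialDeriv f t v i i * z i + S)|
        = |(1 + h * partialDeriv f t v i i) * z i + h * S| := by congr 1; ring
      _ ≤ |(1 + h * partialDeriv f t v i i) * z i| + h * |S| := by
          refine (abs_add_le _ _).trans ?_
          rw [abs_mul h, abs_of_pos hh]
      _ ≤ _ := add_le_add e2 (mul_le_mul_of_nonneg_left e1 hh.le)
      _ = _ := by ring
  have hval : (diagScale u⁻¹ z + h • diagScale u⁻¹ (fderiv ℝ (f t) v z)) i =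
      (u i)⁻¹ * (z i + h * ∑ j, partialDeriv f t v i j * z j) := by
    simp only [Pi.add_apply, Pi.smul_apply, diagScale_apply, fderiv_apply_eq_sum_partialDeriv,
      Pi.inv_apply, smul_eq_mul]
    ring
  rw [hval, Real.norm_eq_abs, abs_mul, abs_inv, abs_of_pos (hu i), inv_mul_le_iff₀ (hu i)]
  refine hsum.trans ?_
  calc (u i + h * ∑ j, compEntry f t v i j * u j) * N ≤ (u i + h * (c * u i)) * N := by
        gcongr; exact hc i
    _ = u i * ((1 + h * c) * N) := by ring

/-! ### Dependence of solutions on the initial state. -/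

theorem IsRegularField.continuous_fderiv {n : ℕ} {f : ℝ → (Fin n → ℝ) → (Fin n → ℝ)} {t₀ : ℝ}
    (hf : IsRegularField f t₀) {t : ℝ} (ht : t₀ ≤ t) :
    Continuous fun x => fderiv ℝ (f t) x :=
  (hf.contDiff t ht).continuous_fderiv one_ne_zero

theorem IsSolution.initial {n : ℕ} {f : ℝ → (Fin n → ℝ) → (Fin n → ℝ)} {s : ℝ}
    {x : Fin n → ℝ} {φ : ℝ → (Fin n → ℝ)} (h : IsSolution f s x φ) : φ s = x := by
  simpa using h.eq s le_rfl

/-- Solutions starting near a given one separate at most at the exponential rate given by the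
weighted row sums of the comparison matrix along it. -/
theorem IsSolution.exists_norm_sub_le_exp {n : ℕ} {f : ℝ → (Fin n → ℝ) → (Fin n → ℝ)} {t₀ : ℝ}
    (hf : IsRegularField f t₀) {s T : ℝ} (hs : t₀ ≤ s) {v : Fin n → ℝ} {φ : ℝ → (Fin n → ℝ)}
    (hφ : IsSolution f s v φ) {u : Fin n → ℝ} (hu : ∀ i, 0 < u i) {c μ : ℝ} (hcμ : c < μ)
    (hc : ∀ t ∈ Icc s T, ∀ i, ∑ j, compEntry f t (φ t) i j * u j ≤ c * u i) :
    ∃ r > 0, ∀ w ψ, IsSolution f s w ψ → ‖diagScale u⁻¹ (w - v)‖ < r → ∀ t ∈ Icc s T,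
      ‖diagScale u⁻¹ (ψ t - φ t)‖ ≤ Real.exp (μ * (t - s)) * ‖diagScale u⁻¹ (w - v)‖ := by
  set W := diagScale u⁻¹ with hW
  set V := diagScale u with hV
  have hVW : ∀ z, V (W z) = z := diagScale_diagScale_inv hu
  have hWV : ∀ z, W (V z) = z := diagScale_inv_diagScale hu
  have hVW' : ∀ z, ‖z‖ ≤ ‖V‖ * ‖W z‖ := fun z => by
    conv_lhs => rw [← hVW z]
    exact V.le_opNorm _
  have hφI : ContinuousOn φ (Icc s T) := hφ.continuousOn.mono Icc_subset_Ici_self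
  set η : ℝ := (μ - c) / 2 with hη
  have hη0 : 0 < η := by rw [hη]; linarith
  -- The mean value estimate is made in the sup norm; passing to the weighted norm costs at most
  -- `‖W‖ * ‖V‖`.
  set η₀ : ℝ := η / (‖W‖ * ‖V‖ + 1) with hη₀
  have hη₀0 : 0 < η₀ := by positivity
  have hη₀η : ‖W‖ * η₀ * ‖V‖ ≤ η := by
    rw [hη₀]
    have : ‖W‖ * (η / (‖W‖ * ‖V‖ + 1)) * ‖V‖ = η * ((‖W‖ * ‖V‖) / (‖W‖ * ‖V‖ + 1)) := by ring
    rw [this]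
    refine mul_le_of_le_one_right hη0.le ((div_le_one (by positivity)).2 (by linarith))
  obtain ⟨M, hM0, hM⟩ := hf.piecewise_jacobian.exists_forall_norm_le
    (fun t ht => hf.continuous_fderiv ht) hs hφI
  obtain ⟨ρ, hρ, hmod⟩ := hf.piecewise_jacobian.exists_forall_dist_le
    (fun t ht => hf.continuous_fderiv ht) hs hφI hη₀0
  set ρ' : ℝ := ρ / (‖V‖ + 1) with hρ'
  have hρ'0 : 0 < ρ' := by positivity
  have hsmall : ∀ z, ‖W z‖ < ρ' → ‖z‖ < ρ := by
    intro z hz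
    rw [hρ', lt_div_iff₀ (by positivity)] at hz
    have := hVW' z
    nlinarith [norm_nonneg (W z)]
  set J : ℝ → (Fin n → ℝ) →L[ℝ] (Fin n → ℝ) := fun r => W ∘L (fderiv ℝ (f r) (φ r)) ∘L V with hJ
  refine ⟨ρ' / Real.exp (|μ| * (T - s)), by positivity, fun w ψ hψ hwv => ?_⟩
  -- The growth estimate needs a positive `β`, so it is applied strictly above the initial distance,
  -- which may vanish; the final contradiction lets `β` decrease.
  have key : ∀ β, ‖W (w - v)‖ < β → β < ρ' / Real.exp (|μ| * (T - s)) → ∀ t ∈ Icc s T,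
      ‖W (ψ t - φ t)‖ ≤ β * Real.exp (μ * (t - s)) := by
    intro β hβ hβρ
    have hβ0 : 0 < β := (norm_nonneg _).trans_lt hβ
    have hgi : ∀ t ∈ Icc s T, IntervalIntegrable (fun r => f r (ψ r) - f r (φ r)) volume s t :=
      fun t ht => (hψ.integrable t ht.1).sub (hφ.integrable t ht.1)
    have hd0 : W (ψ s - φ s) = W (w - v) := by rw [hψ.initial, hφ.initial]
    refine norm_le_mul_exp_of_logNorm_le (d := fun t => W (ψ t - φ t))
      (g := fun r => W (f r (ψ r) - f r (φ r))) (J := J) (M := ‖W‖ * (M * ‖V‖)) (ρ := ρ')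
      (η := η) (h₀ := 1 / (M + 1)) (μ' := c) ?_ ?_ ?_ ?_ hη0.le ?_ (by positivity) ?_ ?_ hβ0 ?_ ?_
    · exact W.continuous.comp_continuousOn
        ((hψ.continuousOn.mono Icc_subset_Ici_self).sub hφI)
    · intro t ht
      exact ⟨W.integrable_comp (hgi t ht).1, W.integrable_comp (hgi t ht).2⟩
    · intro t ht
      rw [W.intervalIntegral_comp_comm (hgi t ht), hd0, ← map_add,
        intervalIntegral.integral_sub (hψ.integrable t ht.1) (hφ.integrable t ht.1),
        hψ.eq t ht.1, hφ.eq t ht.1]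
      congr 1
      abel
    · intro r hr
      refine (ContinuousLinearMap.opNorm_comp_le _ _).trans ?_
      refine mul_le_mul_of_nonneg_left ?_ (norm_nonneg _)
      refine (ContinuousLinearMap.opNorm_comp_le _ _).trans ?_
      exact mul_le_mul_of_nonneg_right (hM r hr) (norm_nonneg _)
    · intro r hr hdr
      have hz := hsmall _ hdr
      have hmv := (convex_ball (φ r) ρ).norm_image_sub_le_of_norm_fderiv_le' (𝕜 := ℝ)
        (f := f r) (φ := fderiv ℝ (f r) (φ r)) (C := η₀) (x := φ r) (y := ψ r)
        (fun x _ => ((hf.contDiff r (hs.trans hr.1)).differentiable one_ne_zero) x)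
        (fun x hx => by simpa [dist_eq_norm] using hmod r hr x hx)
        (Metric.mem_ball_self hρ) (by rwa [Metric.mem_ball, dist_eq_norm])
      simp only [hJ, ContinuousLinearMap.comp_apply, hVW]
      rw [← map_sub]
      calc ‖W (f r (ψ r) - f r (φ r) - fderiv ℝ (f r) (φ r) (ψ r - φ r))‖
          ≤ ‖W‖ * (η₀ * (‖V‖ * ‖W (ψ r - φ r)‖)) := by
            refine (W.le_opNorm _).trans (mul_le_mul_of_nonneg_left (hmv.trans ?_) (norm_nonneg _))
            exact mul_le_mul_of_nonneg_left (hVW' _) hη₀0.le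
        _ = (‖W‖ * η₀ * ‖V‖) * ‖W (ψ r - φ r)‖ := by ring
        _ ≤ η * ‖W (ψ r - φ r)‖ := mul_le_mul_of_nonneg_right hη₀η (norm_nonneg _)
    · intro h hh hh₀ r hr z
      rw [lt_div_iff₀ (by positivity)] at hh₀
      have := norm_add_smul_fderiv_le hu (hM r hr) (hc r hr) hh (by nlinarith) (V z)
      rw [← hW, hWV] at this
      simpa [hJ] using this
    · rw [hη]; linarith
    · rwa [lt_div_iff₀ (by positivity)] at hβρ
    · rw [hd0]; exact hβ.le
  intro t ht
  by_contra! hlt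
  rw [mul_comm, ← lt_div_iff₀ (by positivity)] at hlt
  obtain ⟨β, h1, h2⟩ := exists_between (lt_min hwv hlt)
  rw [lt_min_iff, lt_div_iff₀ (Real.exp_pos (μ * (t - s)))] at h2
  exact absurd (key β h1 h2.1 t ht) (not_le.2 h2.2)

/-- Local Lipschitz dependence of solutions on the initial state, over a compact time interval. -/
theorem IsSolution.exists_norm_sub_le {n : ℕ} {f : ℝ → (Fin n → ℝ) → (Fin n → ℝ)} {t₀ : ℝ}
    (hf : IsRegularField f t₀) {s T : ℝ} (hs : t₀ ≤ s) {v : Fin n → ℝ} {φ : ℝ → (Fin n → ℝ)}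
    (hφ : IsSolution f s v φ) :
    ∃ r > 0, ∃ L > 0, ∀ w ψ, IsSolution f s w ψ → ‖w - v‖ < r → ∀ t ∈ Icc s T,
      ‖ψ t - φ t‖ ≤ L * ‖w - v‖ := by
  obtain ⟨M, hM0, hM⟩ := hf.piecewise_jacobian.exists_forall_norm_le
    (fun t ht => hf.continuous_fderiv ht) hs
    (hφ.continuousOn.mono (Icc_subset_Ici_self : Icc s T ⊆ Ici s))
  have hone : diagScale (1 : Fin n → ℝ)⁻¹ = ContinuousLinearMap.id ℝ _ := by
    ext z i; simp
  have hc : ∀ t ∈ Icc s T, ∀ i,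
      ∑ j, compEntry f t (φ t) i j * (1 : Fin n → ℝ) j ≤ (n * M) * (1 : Fin n → ℝ) i := by
    intro t ht i
    have h1 : ∀ j, |partialDeriv f t (φ t) i j| ≤ M := fun j => by
      rw [← Real.norm_eq_abs]
      refine (norm_le_pi_norm (fderiv ℝ (f t) (φ t) (Pi.single j 1)) i).trans ?_
      refine ((fderiv ℝ (f t) (φ t)).le_opNorm _).trans ?_
      simpa [Pi.norm_single] using hM t ht
    have h2 : ∀ j, compEntry f t (φ t) i j ≤ M := fun j => by
      rw [compEntry]
      split_ifs with hij
      · exact (le_abs_self _).trans (h1 i)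
      · exact h1 j
    calc _ ≤ ∑ j : Fin n, M := Finset.sum_le_sum fun j _ => by simpa using h2 j
      _ = _ := by simp
  obtain ⟨r, hr, H⟩ := hφ.exists_norm_sub_le_exp hf hs (u := 1) (fun _ => one_pos)
    (lt_add_one (n * M)) hc
  rw [hone] at H
  refine ⟨r, hr, Real.exp ((n * M + 1) * (T - s)), Real.exp_pos _, fun w ψ hψ hw t ht => ?_⟩
  refine (H w ψ hψ hw t ht).trans (mul_le_mul_of_nonneg_right (Real.exp_le_exp.2 ?_)
    (norm_nonneg _))
  exact mul_le_mul_of_nonneg_left (by linarith [ht.2]) (by positivity)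

theorem IsSolution.unique {n : ℕ} {f : ℝ → (Fin n → ℝ) → (Fin n → ℝ)} {t₀ : ℝ}
    (hf : IsRegularField f t₀) {s : ℝ} (hs : t₀ ≤ s) {v : Fin n → ℝ} {φ ψ : ℝ → (Fin n → ℝ)}
    (hφ : IsSolution f s v φ) (hψ : IsSolution f s v ψ) {t : ℝ} (ht : s ≤ t) : ψ t = φ t := by
  obtain ⟨r, hr, L, -, H⟩ := hφ.exists_norm_sub_le hf hs (T := t)
  have := H v ψ hψ (by simpa using hr) t ⟨ht, le_rfl⟩
  rw [sub_self, norm_zero, mul_zero, norm_le_zero_iff] at this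
  exact sub_eq_zero.1 this

theorem IsSolution.restart {n : ℕ} {f : ℝ → (Fin n → ℝ) → (Fin n → ℝ)} {s s' : ℝ}
    {v : Fin n → ℝ} {φ : ℝ → (Fin n → ℝ)} (hφ : IsSolution f s v φ) (hs : s ≤ s') :
    IsSolution f s' (φ s') φ where
  continuousOn := hφ.continuousOn.mono (Ici_subset_Ici.2 hs)
  integrable t ht := (hφ.integrable s' hs).symm.trans (hφ.integrable t (hs.trans ht))
  eq t ht := by
    have h := hφ.integrable s' hs
    rw [hφ.eq t (hs.trans ht), hφ.eq s' hs, add_assoc,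
      intervalIntegral.integral_add_adjacent_intervals h
        (h.symm.trans (hφ.integrable t (hs.trans ht)))]

theorem ForwardComplete.isSolution_flow {n : ℕ} {f : ℝ → (Fin n → ℝ) → (Fin n → ℝ)} {t₀ : ℝ}
    (hfc : ForwardComplete f t₀) {s : ℝ} (hs : t₀ ≤ s) (x : Fin n → ℝ) :
    IsSolution f s x fun t => flow f t s x := by
  have h := hfc s hs x
  simp only [flow, dif_pos h]
  exact h.choose_spec

/-- `flow` selects a solution separately for each initial time, so the cocycle identity rests on
uniqueness. -/
theorem ForwardComplete.flow_flow {n : ℕ} {f : ℝ → (Fin n → ℝ) → (Fin n → ℝ)} {t₀ : ℝ}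
    (hfc : ForwardComplete f t₀) (hf : IsRegularField f t₀) {s t : ℝ} (hs : t₀ ≤ s) (hst : s ≤ t)
    (x : Fin n → ℝ) : flow f t s (flow f s t₀ x) = flow f t t₀ x :=
  ((hfc.isSolution_flow le_rfl x).restart hs).unique hf hs (hfc.isSolution_flow hs _) hst

/-! ### Expansion of the flow on convex sets. -/

/-- A map of an interval that is pointwise locally `c`-Lipschitz does not expand the length of the
interval by more than `c`. -/
theorem norm_sub_le_of_forall_eventually {E : Type*} [NormedAddCommGroup E] {G : ℝ → E} {c : ℝ}
    (hG : ∀ σ ∈ Icc (0 : ℝ) 1, ∀ᶠ σ' in 𝓝 σ, σ' ∈ Icc (0 : ℝ) 1 →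
      ‖G σ' - G σ‖ ≤ c * |σ' - σ|) : ‖G 1 - G 0‖ ≤ c := by
  have hcont : ContinuousOn G (Icc 0 1) := by
    intro σ hσ
    rw [ContinuousWithinAt, tendsto_iff_norm_sub_tendsto_zero]
    have hlim : Tendsto (fun σ' => c * |σ' - σ|) (𝓝[Icc 0 1] σ) (𝓝 0) := by
      have : Continuous fun σ' => c * |σ' - σ| := by fun_prop
      simpa using (this.tendsto σ).mono_left nhdsWithin_le_nhds
    refine squeeze_zero' (Eventually.of_forall fun _ => norm_nonneg _) ?_ hlim
    exact eventually_nhdsWithin_iff.2 (hG σ hσ)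
  have key : Icc (0 : ℝ) 1 ⊆ {σ | ‖G σ - G 0‖ ≤ c * σ} := by
    refine IsClosed.Icc_subset_of_forall_exists_gt ?_ (by simp) ?_
    · have hG' : ContinuousOn (fun σ => ‖G σ - G 0‖) (Icc 0 1) :=
        (hcont.sub continuousOn_const).norm
      have hc' : ContinuousOn (fun σ => c * σ) (Icc (0 : ℝ) 1) := by fun_prop
      have := isClosed_Icc.isClosed_le hG' hc'
      convert this using 1
      ext t; simp [and_comm]
    · rintro σ ⟨hσG, hσ⟩ y hy
      obtain ⟨δ, hδ, H⟩ := Metric.eventually_nhds_iff.1 (hG σ ⟨hσ.1, hσ.2.le⟩)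
      have hy : σ < y := hy
      obtain ⟨σ', h1, h2⟩ := exists_between
        (show σ < min (min y 1) (σ + δ) by
          simp only [lt_min_iff]; exact ⟨⟨hy, hσ.2⟩, by linarith⟩)
      simp only [lt_min_iff] at h2
      have h3 : |σ' - σ| = σ' - σ := abs_of_pos (by linarith)
      have h4 := H (y := σ') (by rw [Real.dist_eq, h3]; linarith)
        ⟨hσ.1.trans h1.le, h2.1.2.le⟩
      refine ⟨σ', ?_, h1, h2.1.1.le⟩
      rw [h3] at h4
      have hσG : ‖G σ - G 0‖ ≤ c * σ := hσG
      have h5 : ‖G σ' - G 0‖ ≤ ‖G σ' - G σ‖ + ‖G σ - G 0‖ := norm_sub_le_norm_sub_add_norm_sub ..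
      show ‖G σ' - G 0‖ ≤ c * σ'
      linarith
  simpa using key (right_mem_Icc.2 zero_le_one)

/-- The flow expands a weighted sup norm on a convex set at most at an exponential rate that bounds
the weighted row sums of the comparison matrix along all trajectories issued from that set. -/
theorem ForwardComplete.norm_flow_sub_flow_le {n : ℕ} {f : ℝ → (Fin n → ℝ) → (Fin n → ℝ)}
    {t₀ : ℝ} (hfc : ForwardComplete f t₀) (hf : IsRegularField f t₀) {s : ℝ} (hs : t₀ ≤ s)
    {C : Set (Fin n → ℝ)} (hC : Convex ℝ C) {u : Fin n → ℝ} (hu : ∀ i, 0 < u i) {c μ : ℝ}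
    (hcμ : c < μ)
    (hc : ∀ t, s ≤ t → ∀ v ∈ C, ∀ i, ∑ j, compEntry f t (flow f t s v) i j * u j ≤ c * u i)
    {v w : Fin n → ℝ} (hv : v ∈ C) (hw : w ∈ C) {t : ℝ} (ht : s ≤ t) :
    ‖diagScale u⁻¹ (flow f t s w - flow f t s v)‖ ≤
      Real.exp (μ * (t - s)) * ‖diagScale u⁻¹ (w - v)‖ := by
  set W := diagScale u⁻¹ with hW
  have hline : ∀ σ ∈ Icc (0 : ℝ) 1, AffineMap.lineMap v w σ ∈ C := fun σ hσ =>
    hC.lineMap_mem hv hw hσ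
  have hdiff : ∀ σ σ' : ℝ, (AffineMap.lineMap v w σ' - AffineMap.lineMap v w σ : Fin n → ℝ)
      = (σ' - σ) • (w - v) := by
    intro σ σ'
    simp only [AffineMap.lineMap_apply_module']
    module
  -- The radius of validity varies with the point of the segment but the expansion factor does not,
  -- so the local estimates chain without loss.
  have := norm_sub_le_of_forall_eventually
    (G := fun σ => W (flow f t s (AffineMap.lineMap v w σ)))
    (c := Real.exp (μ * (t - s)) * ‖W (w - v)‖) ?_
  · simpa using this
  · intro σ hσ
    obtain ⟨r, hr, H⟩ := (hfc.isSolution_flow hs (AffineMap.lineMap v w σ)).exists_norm_sub_le_exp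
      hf hs hu hcμ (T := t) fun τ hτ => hc τ hτ.1 _ (hline σ hσ)
    have hlim : Tendsto (fun σ' : ℝ => ‖W ((σ' - σ) • (w - v))‖) (𝓝 σ) (𝓝 0) := by
      have : Continuous fun σ' : ℝ => ‖W ((σ' - σ) • (w - v))‖ := by fun_prop
      simpa using this.tendsto σ
    filter_upwards [hlim.eventually_lt_const hr] with σ' h1 _
    rw [← hdiff] at h1
    have := H _ _ (hfc.isSolution_flow hs (AffineMap.lineMap v w σ')) h1 t ⟨ht, le_rfl⟩
    rw [hdiff, map_smul, norm_smul, map_sub, Real.norm_eq_abs] at this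
    exact this.trans_eq (by ring)

/-! ### Counting spanning sets. -/

theorem exists_pos_seminorm_le_mul_norm {n : ℕ} (p : Seminorm ℝ (Fin n → ℝ)) :
    ∃ C > 0, ∀ z, p z ≤ C * ‖z‖ := by
  refine ⟨∑ i, p (Pi.single i 1) + 1,
    add_pos_of_nonneg_of_pos (Finset.sum_nonneg fun i _ => apply_nonneg p _) one_pos, fun z => ?_⟩
  have hz : z = ∑ j, z j • Pi.single (M := fun _ => ℝ) j (1 : ℝ) := by
    simp [← Pi.single_smul, Finset.univ_sum_single]
  have h1 : p z ≤ ∑ j, p (z j • Pi.single j 1) := by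
    conv_lhs => rw [hz]
    exact Finset.le_sum_of_subadditive p (map_zero p).le (map_add_le_add p) _ _
  have h2 : ∑ j, p (z j • Pi.single j 1) ≤ ∑ j, ‖z‖ * p (Pi.single j 1) := by
    refine Finset.sum_le_sum fun j _ => ?_
    rw [map_smul_eq_mul]
    exact mul_le_mul_of_nonneg_right (norm_le_pi_norm z j) (apply_nonneg p _)
  rw [← Finset.mul_sum] at h2
  nlinarith [norm_nonneg z]

/-- Spanning points must lie in `K`, so one representative in `K` is taken from each nonempty class
of `k`. -/
theorem spanningNumber_le_card {n : ℕ} {p : Seminorm ℝ (Fin n → ℝ)}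
    {f : ℝ → (Fin n → ℝ) → (Fin n → ℝ)} {t₀ ε T : ℝ} {K : Set (Fin n → ℝ)} {ι : Type*}
    (S : Finset ι) (k : (Fin n → ℝ) → ι) (hkS : ∀ x ∈ K, k x ∈ S)
    (hk : ∀ x ∈ K, ∀ y ∈ K, k x = k y → y ∈ ball p f t₀ x ε T) :
    spanningNumber p f t₀ ε T K ≤ S.card := by
  obtain ⟨E, hEK, hE⟩ := exists_subset_bijOn K k
  have hcov : K ⊆ ⋃ x ∈ E, ball p f t₀ x ε T := by
    intro y hy
    obtain ⟨x, hx, hxy⟩ := hE.surjOn (mem_image_of_mem k hy)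
    exact mem_iUnion₂.2 ⟨x, hx, hk x (hEK hx) y hy hxy⟩
  refine (iInf₂_le E ⟨hEK, hcov⟩).trans ?_
  rw [← hE.injOn.encard_image, hE.image_eq, ← encard_coe_eq_coe_finsetCard]
  exact encard_le_encard (image_subset_iff.2 hkS)

theorem ForwardComplete.continuous_flow {n : ℕ} {f : ℝ → (Fin n → ℝ) → (Fin n → ℝ)} {t₀ : ℝ}
    (hfc : ForwardComplete f t₀) (hf : IsRegularField f t₀) {s t : ℝ} (hs : t₀ ≤ s) (ht : s ≤ t) :
    Continuous fun x => flow f t s x := by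
  refine continuous_iff_continuousAt.2 fun v => ?_
  obtain ⟨r, hr, L, -, H⟩ := (hfc.isSolution_flow hs v).exists_norm_sub_le hf hs (T := t)
  rw [ContinuousAt, tendsto_iff_norm_sub_tendsto_zero]
  have hlim : Tendsto (fun w => L * ‖w - v‖) (𝓝 v) (𝓝 0) := by
    have : Continuous fun w => L * ‖w - v‖ := by fun_prop
    simpa using this.tendsto v
  refine squeeze_zero' (Eventually.of_forall fun _ => norm_nonneg _) ?_ hlim
  filter_upwards [Metric.ball_mem_nhds v hr] with w hw
  exact H w _ (hfc.isSolution_flow hs w) (by rwa [← dist_eq_norm]) t ⟨ht, le_rfl⟩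

/-- Over a bounded time interval, a compact set of initial states splits into finitely many classes
on which trajectories stay `ε`-close. -/
theorem ForwardComplete.exists_finset_classes {n : ℕ} {f : ℝ → (Fin n → ℝ) → (Fin n → ℝ)}
    {t₀ : ℝ} (hfc : ForwardComplete f t₀) (hf : IsRegularField f t₀) (p : Seminorm ℝ (Fin n → ℝ))
    {K : Set (Fin n → ℝ)} (hK : IsCompact K) (t₁ : ℝ) {ε : ℝ} (hε : 0 < ε) :
    ∃ (S : Finset (Fin n → ℝ)) (a : (Fin n → ℝ) → (Fin n → ℝ)), (∀ x ∈ K, a x ∈ S) ∧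
      ∀ x ∈ K, ∀ y ∈ K, a x = a y → ∀ t ∈ Icc t₀ t₁, p (flow f t t₀ y - flow f t t₀ x) < ε := by
  obtain ⟨C, hC, hp⟩ := exists_pos_seminorm_le_mul_norm p
  have hloc : ∀ v, ∃ δ > 0, ∀ w, ‖w - v‖ < δ → ∀ t ∈ Icc t₀ t₁,
      p (flow f t t₀ w - flow f t t₀ v) < ε / 2 := by
    intro v
    obtain ⟨r, hr, L, hL, H⟩ := (hfc.isSolution_flow le_rfl v).exists_norm_sub_le hf le_rfl
      (T := t₁)
    refine ⟨min r (ε / 2 / (C * L)), lt_min hr (by positivity), fun w hw t ht => ?_⟩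
    have h1 := H w _ (hfc.isSolution_flow le_rfl w) (hw.trans_le (min_le_left _ _)) t ht
    have h2 := hw.trans_le (min_le_right _ _)
    rw [lt_div_iff₀ (by positivity)] at h2
    calc p (flow f t t₀ w - flow f t t₀ v) ≤ C * (L * ‖w - v‖) :=
          (hp _).trans (mul_le_mul_of_nonneg_left h1 hC.le)
      _ = ‖w - v‖ * (C * L) := by ring
      _ < ε / 2 := h2
  choose δ hδ hδε using hloc
  obtain ⟨S, -, hS⟩ := hK.elim_nhds_subcover (fun v => Metric.ball v (δ v))
    fun v _ => Metric.ball_mem_nhds v (hδ v)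
  have hex : ∀ x, ∃ v, x ∈ K → v ∈ S ∧ x ∈ Metric.ball v (δ v) := by
    intro x
    by_cases hx : x ∈ K
    · obtain ⟨v, hv, hxv⟩ := mem_iUnion₂.1 (hS hx)
      exact ⟨v, fun _ => ⟨hv, hxv⟩⟩
    · exact ⟨0, fun h => absurd h hx⟩
  choose a ha using hex
  refine ⟨S, a, fun x hx => (ha x hx).1, fun x hx y hy hxy t ht => ?_⟩
  have h1 := hδε (a x) x (by rw [← dist_eq_norm]; exact (ha x hx).2) t ht
  have h2 := hδε (a x) y (by rw [← dist_eq_norm, hxy]; exact (ha y hy).2) t ht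
  have h3 : flow f t t₀ y - flow f t t₀ x = (flow f t t₀ y - flow f t t₀ (a x)) -
      (flow f t t₀ x - flow f t t₀ (a x)) := by abel
  rw [h3]
  exact (map_sub_le_add p _ _).trans_lt (by linarith)

/-- Exponential bound on the spanning numbers from an exponential bound on the expansion of the flow
in a weighted sup norm. -/
theorem ForwardComplete.exists_spanningNumber_le {n : ℕ} {f : ℝ → (Fin n → ℝ) → (Fin n → ℝ)}
    {t₀ : ℝ} (hfc : ForwardComplete f t₀) (hf : IsRegularField f t₀) (p : Seminorm ℝ (Fin n → ℝ))
    {K : Set (Fin n → ℝ)} (hK : IsCompact K) {t₁ : ℝ} (ht₁ : t₀ ≤ t₁) {u : Fin n → ℝ}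
    (hu : ∀ i, 0 < u i) {μ : ℝ} (hμ : 0 ≤ μ)
    (hexp : ∀ x ∈ K, ∀ y ∈ K, ∀ t, t₁ ≤ t →
      ‖diagScale u⁻¹ (flow f t t₀ y - flow f t t₀ x)‖ ≤
        Real.exp (μ * (t - t₁)) * ‖diagScale u⁻¹ (flow f t₁ t₀ y - flow f t₁ t₀ x)‖)
    {ε : ℝ} (hε : 0 < ε) :
    ∃ D : ℝ, ∀ T, 0 ≤ T →
      (spanningNumber p f t₀ ε T K : ENNReal) ≤ ENNReal.ofReal (Real.exp (D + n * μ * T)) := by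
  obtain ⟨C, hC, hp⟩ := exists_pos_seminorm_le_mul_norm p
  obtain ⟨S, a, haS, ha⟩ := hfc.exists_finset_classes hf p hK t₁ hε
  set W := diagScale u⁻¹ with hW
  set V := diagScale u with hV
  obtain ⟨R, hR0, hR⟩ : ∃ R, 0 ≤ R ∧ ∀ x ∈ K, ‖W (flow f t₁ t₀ x)‖ ≤ R := by
    have hcont : Continuous fun x => W (flow f t₁ t₀ x) :=
      W.continuous.comp (hfc.continuous_flow hf le_rfl ht₁)
    obtain ⟨R, hR⟩ := hK.exists_bound_of_continuousOn hcont.continuousOn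
    exact ⟨|R|, abs_nonneg _, fun x hx => (hR x hx).trans (le_abs_self _)⟩
  -- Weighted distance at most `ε₁` forces `p`-distance below `ε`; the `+ 1` keeps the inequality
  -- strict and the denominator positive.
  set ε₁ : ℝ := ε / (C * ‖V‖ + 1) with hε₁
  have hε₁0 : 0 < ε₁ := by positivity
  have hε₁ε : C * ‖V‖ * ε₁ < ε := by
    rw [hε₁, mul_div_assoc', div_lt_iff₀ (by positivity)]
    nlinarith
  -- The classes on `[t₀, t₁]` number at most `exp S.card`, and each coordinate contributes at most
  -- `exp (2 * R / ε₁ + 3 + μ * T)` grid indices.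
  refine ⟨S.card + n * (2 * R / ε₁ + 3), fun T hT => ?_⟩
  -- The mesh is `ε₁` divided by the largest expansion possible up to time `t₀ + T`.
  set ℓ : ℝ := ε₁ / Real.exp (μ * T) with hℓ
  have hℓ0 : 0 < ℓ := by positivity
  set m : ℕ := ⌈R / ℓ⌉₊ with hm
  have hmR : R / ℓ ≤ m := Nat.le_ceil _
  set cells : Finset (Fin n → ℤ) := Fintype.piFinset fun _ => Finset.Icc (-(m : ℤ)) m with hcells
  have hspan : spanningNumber p f t₀ ε T K ≤ (S ×ˢ cells).card := by
    refine spanningNumber_le_card (S ×ˢ cells)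
      (fun x => (a x, fun i => ⌊W (flow f t₁ t₀ x) i / ℓ⌋)) (fun x hx => ?_)
      fun x hx y hy hxy t ht => ?_
    · refine Finset.mem_product.2 ⟨haS x hx, Fintype.mem_piFinset.2 fun i => ?_⟩
      have h1 := (norm_le_pi_norm (W (flow f t₁ t₀ x)) i).trans (hR x hx)
      rw [Real.norm_eq_abs, abs_le] at h1
      have h2 : W (flow f t₁ t₀ x) i / ℓ ≤ m :=
        (div_le_div_of_nonneg_right h1.2 hℓ0.le).trans hmR
      have h3 : -(m : ℝ) ≤ W (flow f t₁ t₀ x) i / ℓ := by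
        refine le_trans ?_ (div_le_div_of_nonneg_right h1.1 hℓ0.le)
        rw [neg_div]; exact neg_le_neg hmR
      refine Finset.mem_Icc.2 ⟨Int.le_floor.2 (by exact_mod_cast h3), ?_⟩
      exact_mod_cast (Int.floor_le _).trans h2
    · rw [Prod.mk.injEq] at hxy
      rcases le_total t t₁ with htt | htt
      · exact ha x hx y hy hxy.1 t ⟨ht.1, htt⟩
      · have h1 : ‖W (flow f t₁ t₀ y - flow f t₁ t₀ x)‖ ≤ ℓ := by
          refine (pi_norm_le_iff_of_nonneg hℓ0.le).2 fun i => ?_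
          have h2 := Int.abs_sub_lt_one_of_floor_eq_floor (congrFun hxy.2 i).symm
          rw [← sub_div, abs_div, abs_of_pos hℓ0, div_lt_one hℓ0] at h2
          rw [map_sub, Pi.sub_apply, Real.norm_eq_abs]
          exact h2.le
        have h2 : ‖W (flow f t t₀ y - flow f t t₀ x)‖ ≤ ε₁ := by
          refine (hexp x hx y hy t htt).trans ?_
          calc _ ≤ Real.exp (μ * T) * ℓ := by
                refine mul_le_mul (Real.exp_le_exp.2 ?_) h1 (norm_nonneg _) (Real.exp_pos _).le
                exact mul_le_mul_of_nonneg_left (by linarith [ht.2]) hμ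
            _ = ε₁ := by rw [hℓ]; field_simp
        have h3 := V.le_opNorm (W (flow f t t₀ y - flow f t t₀ x))
        rw [hW, hV, diagScale_diagScale_inv hu, ← hW, ← hV] at h3
        calc _ ≤ C * (‖V‖ * ε₁) := (hp _).trans (mul_le_mul_of_nonneg_left
              (h3.trans (mul_le_mul_of_nonneg_left h2 (norm_nonneg _))) hC.le)
          _ = C * ‖V‖ * ε₁ := by ring
          _ < ε := hε₁ε
  have hcard : ((S ×ˢ cells).card : ℝ) = S.card * (2 * m + 1) ^ n := by
    have hI : (Finset.Icc (-(m : ℤ)) m).card = 2 * m + 1 := by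
      rw [Int.card_Icc]; omega
    rw [Finset.card_product, hcells, Fintype.card_piFinset]
    simp [hI]
  have hE1 : 1 ≤ Real.exp (μ * T) := Real.one_le_exp (mul_nonneg hμ hT)
  have hm2 : 2 * (m : ℝ) + 1 ≤ Real.exp (2 * R / ε₁ + 3 + μ * T) := by
    have h1 : (m : ℝ) < R / ℓ + 1 := Nat.ceil_lt_add_one (by positivity)
    have h2 : R / ℓ = R / ε₁ * Real.exp (μ * T) := by rw [hℓ]; field_simp
    calc 2 * (m : ℝ) + 1 ≤ 2 * (R / ε₁ * Real.exp (μ * T)) + 3 := by rw [← h2]; linarith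
      -- Here `1 ≤ exp (μ * T)` is used: without expansion the count still does not fall below a
      -- constant, whence the `max` with `0`.
      _ ≤ (2 * R / ε₁ + 3) * Real.exp (μ * T) := by
          have : 2 * R / ε₁ = 2 * (R / ε₁) := by ring
          rw [this]; linarith
      _ ≤ Real.exp (2 * R / ε₁ + 3) * Real.exp (μ * T) := by
          refine mul_le_mul_of_nonneg_right ?_ (Real.exp_pos _).le
          linarith [Real.add_one_le_exp (2 * R / ε₁ + 3)]
      _ = _ := (Real.exp_add _ _).symm
  have hreal : ((S ×ˢ cells).card : ℝ) ≤
      Real.exp (S.card + n * (2 * R / ε₁ + 3) + n * μ * T) := by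
    rw [hcard]
    calc (S.card : ℝ) * (2 * m + 1) ^ n
        ≤ Real.exp S.card * Real.exp (2 * R / ε₁ + 3 + μ * T) ^ n := by
          refine mul_le_mul ?_ (pow_le_pow_left₀ (by positivity) hm2 n) (by positivity)
            (Real.exp_pos _).le
          linarith [Real.add_one_le_exp (S.card : ℝ)]
      _ = _ := by rw [← Real.exp_nat_mul, ← Real.exp_add]; congr 1; ring
  calc (spanningNumber p f t₀ ε T K : ENNReal) ≤ (((S ×ˢ cells).card : ℕ∞) : ENNReal) :=
        ENat.toENNReal_le.2 hspan
    _ = ENNReal.ofReal ((S ×ˢ cells).card : ℝ) := by simp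
    _ ≤ _ := ENNReal.ofReal_le_ofReal hreal

/-! ### The entropy bound. -/

theorem limsup_log_div_le {N : ℝ → ENNReal} {D c : ℝ}
    (hN : ∀ T, 0 ≤ T → N T ≤ ENNReal.ofReal (Real.exp (D + c * T))) :
    limsup (fun T : ℝ => ENNReal.log (N T) / (T : EReal)) atTop ≤ (c : EReal) := by
  have hlim : Tendsto (fun T : ℝ => (D + c * T) / T) atTop (𝓝 c) := by
    have h1 : Tendsto (fun T : ℝ => D / T + c) atTop (𝓝 (0 + c)) :=
      (tendsto_const_nhds.div_atTop tendsto_id).add_const c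
    rw [zero_add] at h1
    refine h1.congr' ?_
    filter_upwards [eventually_gt_atTop 0] with T hT
    field_simp
  have hlim' := (continuous_coe_real_ereal.tendsto c).comp hlim
  rw [← hlim'.limsup_eq]
  refine limsup_le_limsup ?_
  filter_upwards [eventually_gt_atTop 0] with T hT
  have h1 : ENNReal.log (N T) ≤ ((D + c * T : ℝ) : EReal) := by
    refine (ENNReal.log_monotone (hN T hT.le)).trans ?_
    rw [ENNReal.log_ofReal_of_pos (Real.exp_pos _), Real.log_exp]
  rw [Function.comp_apply, EReal.coe_div]
  exact EReal.div_le_div_right_of_nonneg (by exact_mod_cast hT.le) h1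

theorem compEntry_le_of_supEntry_le {n : ℕ} {f : ℝ → (Fin n → ℝ) → (Fin n → ℝ)} {t₀ t₁ b : ℝ}
    {K : Set (Fin n → ℝ)} {i j : Fin n} (h : supEntry f t₀ K t₁ i j ≤ (b : EReal)) {t : ℝ}
    (ht : t₁ ≤ t) {v : Fin n → ℝ} (hv : v ∈ convexHull ℝ (flow f t₁ t₀ '' K)) :
    compEntry f t (flow f t t₁ v) i j ≤ b := by
  have h1 := (le_iSup₂_of_le (f := fun t (_ : t ∈ Ici t₁) =>
    ⨆ v ∈ convexHull ℝ (flow f t₁ t₀ '' K), (compEntry f t (flow f t t₁ v) i j : EReal)) t ht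
    (le_iSup₂_of_le v hv le_rfl)).trans h
  exact_mod_cast h1

/-- Strict weighted row-sum inequalities survive a small perturbation of the entries. -/
theorem exists_pos_sum_add_mul_le {n : ℕ} {A : Matrix (Fin n) (Fin n) ℝ} {u : Fin n → ℝ} {c : ℝ}
    (h : ∀ i, ∑ j, A i j * u j < c * u i) :
    ∃ δ > 0, ∀ i, ∑ j, (A i j + δ) * u j ≤ c * u i := by
  have hev : ∀ᶠ δ : ℝ in 𝓝 0, ∀ i, ∑ j, (A i j + δ) * u j < c * u i := by
    refine eventually_all.2 fun i => ?_
    have hcont : Continuous fun δ : ℝ => ∑ j, (A i j + δ) * u j := by fun_prop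
    exact (hcont.tendsto 0).eventually_lt_const (by simpa using h i)
  obtain ⟨δ, hδ, hδ0⟩ := ((hev.filter_mono nhdsWithin_le_nhds).and
    (self_mem_nhdsWithin : Ioi (0 : ℝ) ∈ 𝓝[>] 0)).exists
  exact ⟨δ, hδ0, fun i => (hδ i).le⟩

theorem growthRate_le_of_spectralAbscissa_lt {n : ℕ} (p : Seminorm ℝ (Fin n → ℝ))
    {f : ℝ → (Fin n → ℝ) → (Fin n → ℝ)} {t₀ : ℝ} (hf : IsRegularField f t₀)
    (hfc : ForwardComplete f t₀) {K : Set (Fin n → ℝ)} (hK : IsCompact K)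
    {A : Matrix (Fin n) (Fin n) ℝ} (hA : IsMetzler A)
    (hAbound : ∀ δ : ℝ, 0 < δ → ∃ t₁ : ℝ, t₀ ≤ t₁ ∧
      ∀ i j : Fin n, supEntry f t₀ K t₁ i j ≤ ((A i j + δ : ℝ) : EReal))
    {μ : ℝ} (hμ : 0 ≤ μ) (hAμ : spectralAbscissa A < μ) {ε : ℝ} (hε : 0 < ε) :
    growthRate p f t₀ K ε ≤ ((n * μ : ℝ) : EReal) := by
  -- The weights `u` depend only on `A` and `c`, then `δ` on `u`, and only then is `t₁` chosen; one
  -- `t₁` must serve all entries, as the row sums combine them.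
  obtain ⟨c, hAc, hcμ⟩ := exists_between hAμ
  obtain ⟨u, hu, huA⟩ := hA.exists_pos_mulVec_lt hAc
  obtain ⟨δ, hδ, hδA⟩ := exists_pos_sum_add_mul_le huA
  obtain ⟨t₁, ht₁, hsup⟩ := hAbound δ hδ
  have hexp : ∀ x ∈ K, ∀ y ∈ K, ∀ t, t₁ ≤ t →
      ‖diagScale u⁻¹ (flow f t t₀ y - flow f t t₀ x)‖ ≤
        Real.exp (μ * (t - t₁)) * ‖diagScale u⁻¹ (flow f t₁ t₀ y - flow f t₁ t₀ x)‖ := by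
    intro x hx y hy t ht
    have := hfc.norm_flow_sub_flow_le hf ht₁ (convex_convexHull ℝ (flow f t₁ t₀ '' K)) hu hcμ
      (fun t ht v hv i => (Finset.sum_le_sum fun j _ => mul_le_mul_of_nonneg_right
        (compEntry_le_of_supEntry_le (hsup i j) ht hv) (hu j).le).trans (hδA i))
      (subset_convexHull ℝ _ (mem_image_of_mem _ hx))
      (subset_convexHull ℝ _ (mem_image_of_mem _ hy)) ht
    rwa [hfc.flow_flow hf ht₁ ht, hfc.flow_flow hf ht₁ ht] at this
  obtain ⟨D, hD⟩ := hfc.exists_spanningNumber_le hf p hK ht₁ hu hμ hexp hε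
  exact limsup_log_div_le hD

end TVEntropy

open TVEntropy in
theorem corollary3 {n : ℕ} (p : Seminorm ℝ (Fin n → ℝ)) (hp : ∀ x, p x = 0 → x = 0)
    (f : ℝ → (Fin n → ℝ) → (Fin n → ℝ)) (t₀ : ℝ)
    (hf : IsRegularField f t₀) (hfc : ForwardComplete f t₀)
    (K : Set (Fin n → ℝ)) (hK : IsCompact K) (hKint : (interior K).Nonempty)
    (A : Matrix (Fin n) (Fin n) ℝ) (hA : IsMetzler A)
    (hAbound : ∀ δ : ℝ, 0 < δ → ∃ t₁ : ℝ, t₀ ≤ t₁ ∧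
      ∀ i j : Fin n, supEntry f t₀ K t₁ i j ≤ ((A i j + δ : ℝ) : EReal)) :
    entropy p f t₀ K ≤ (((n : ℝ) * max (spectralAbscissa A) 0 : ℝ) : EReal) := by
  refine iSup₂_le fun ε hε => ?_
  -- The estimate holds only strictly above the threshold, so the bound is reached as a limit from
  -- the right.
  have hlim : Tendsto (fun μ : ℝ => ((n * μ : ℝ) : EReal)) (𝓝[>] (max (spectralAbscissa A) 0))
      (𝓝 ((n * max (spectralAbscissa A) 0 : ℝ) : EReal)) := by
    have : Continuous fun μ : ℝ => ((n * μ : ℝ) : EReal) :=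
      continuous_coe_real_ereal.comp (by fun_prop)
    exact (this.tendsto _).mono_left nhdsWithin_le_nhds
  refine ge_of_tendsto hlim ?_
  filter_upwards [self_mem_nhdsWithin] with μ hμ
  have hμ : max (spectralAbscissa A) 0 < μ := hμ
  exact growthRate_le_of_spectralAbscissa_lt p hf hfc hK hA hAbound
    ((le_max_right _ _).trans hμ.le) ((le_max_left _ _).trans_lt hμ) hε
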